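/- Let $k$ be a positive integer and put $p_k=\log_2\binom{2k}{k}$. A lazy simple random walk on $\mathbb{Z}$ is a process $S_n=X_1+\cdots+X_n$, $n\ge 0$ (so $S_0=0$), where $X_1,X_2,\ldots$ are independent identically distributed random variables with values in $\{-1,0,1\}$ and $\mathbb{P}(X_1=0)=1/2$ (the walk need not be symmetric). Then for every lazy simple random walk $(S_n)_{n=0}^\infty$ on $\mathbb{Z}$, $$\mathbb{P}(S_k=0)^{1/p_k}\le \mathbb{P}(S_k=-k)^{1/p_k}+\mathbb{P}(S_k=k)^{1/p_k}.$$ Moreover, for this fixed $k$, $p_k$ is the smallest number $p>0$ such that $\mathbb{P}(S_k=0)^{1/p}\le \mathbb{P}(S_k=-k)^{1/p}+\mathbb{P}(S_k=k)^{1/p}$ holds for every lazy simple random walk $(S_n)_{n=0}^\infty$ on $\mathbb{Z}$. -/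

import Mathlib

open MeasureTheory ProbabilityTheory

universe u

/-- The exponent `p_k = log₂ (2k choose k)`. -/
noncomputable def criticalExponent (k : ℕ) : ℝ :=
  Real.logb 2 ((2 * k).choose k : ℝ)

/-- `S` is a lazy simple random walk on `ℤ` started at `0`: there are independent, identically
distributed steps with values in `{-1, 0, 1}`, each equal to `0` with probability `1/2`, whose
partial sums are the `S n`. The steps are indexed from `0`, so `X i` is the `(i+1)`-st step. -/
def IsLazySimpleRandomWalk {Ω : Type u} [MeasurableSpace Ω] (μ : Measure Ω)
    (S : ℕ → Ω → ℤ) : Prop :=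
  ∃ X : ℕ → Ω → ℤ,
    (∀ i, Measurable (X i)) ∧
    iIndepFun X μ ∧
    (∀ i, IdentDistrib (X i) (X 0) μ μ) ∧
    (∀ i ω, X i ω = -1 ∨ X i ω = 0 ∨ X i ω = 1) ∧
    μ {ω | X 0 ω = 0} = 1 / 2 ∧
    ∀ n ω, S n ω = ∑ i ∈ Finset.range n, X i ω

/-! Let the steps `1` and `-1` have probabilities `x/2` and `y/2`, so `x + y = 1`. Since `xT + 1 +
y/T = (xT + y)(1 + 1/T)`, the return probability is `2⁻ᵏ ∑ C(k,j)² xʲ yᵏ⁻ʲ`, and the claim becomes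
`∑ C(k,j)² xʲ yᵏ⁻ʲ ≤ (x^r + y^r)^p` with `p = p_k` and `r = k/p`. Equality at `x = y` is the
definition of `p`, so the symmetric walk gives minimality.

By homogeneity and symmetry take `y = 1`, `x = eˢ`, `s ≤ 0`, and let `D` be the difference of
logarithms, right minus left. For `k ≥ 2` one has `1/2 < r < 1`; `D` vanishes at `0`, and at `-∞` it
tends to `0` through positive values. If `D` were negative somewhere, it would have a local maximum
to the left of a local minimum. The hypergeometric equation for the sum (`squareBinomMoment_ode`)
rules this out: at a critical point it turns `D''` into a positive multiple of `r - k
sinh((2r-1)t)/sinh t`, `t = -s/2`, which is strictly decreasing in `s`. -/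

/-! ### Calculus: extrema on a half-line and a ratio of hyperbolic sines. -/

open Filter Topology in
/-- A smooth function on `(-∞, 0]` which is eventually positive at `-∞`, tends to `0` there and
is nonnegative at `0` is nonnegative, as soon as a candidate for a local maximum never lies to the
left of a candidate for a local minimum. -/
lemma nonneg_of_no_max_before_min {D D₁ D₂ : ℝ → ℝ} (hD : ∀ s, HasDerivAt D (D₁ s) s)
    (hD₁ : ∀ s, HasDerivAt D₁ (D₂ s) s) (h0 : 0 ≤ D 0) (hlim : Tendsto D atBot (𝓝 0))
    {s₀ : ℝ} (hpos : ∀ s ≤ s₀, 0 < D s)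
    (hcrit : ∀ s t, s < t → t < 0 → D₁ s = 0 → D₁ t = 0 → D₂ s ≤ 0 → 0 ≤ D₂ t → False)
    {s : ℝ} (hs : s ≤ 0) : 0 ≤ D s := by
  by_contra! hneg
  have hderiv : deriv D = D₁ := funext fun s => (hD s).deriv
  have hderiv' : deriv D₁ = D₂ := funext fun s => (hD₁ s).deriv
  have hcont : Continuous D := continuous_iff_continuousAt.2 fun s => (hD s).continuousAt
  -- The second derivative test needs a strict sign. A wrong strict sign would make `t` both a local
  -- minimum and a local maximum, so `D` would be locally constant and `D₂ t = 0`.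
  have hsecond : ∀ t, (𝓝 t).Eventually (fun u => D u = D t) → D₂ t = 0 := by
    intro t ht
    have h1 : D₁ =ᶠ[𝓝 t] fun _ => 0 := by
      have : D =ᶠ[𝓝 t] fun _ => D t := ht
      have := this.deriv
      rw [hderiv] at this
      simpa using this
    have := h1.deriv_eq
    rw [hderiv'] at this
    simpa using this
  have hmin2 : ∀ t, IsLocalMin D t → 0 ≤ D₂ t := by
    intro t ht
    by_contra! hlt
    have hmax : IsLocalMax D t := isLocalMax_of_deriv_deriv_neg (by rw [hderiv, hderiv']; exact hlt)
      ht.deriv_eq_zero hcont.continuousAt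
    exact hlt.ne (hsecond t (by
      filter_upwards [ht, hmax] with u h1 h2 using le_antisymm h2 h1))
  have hmax2 : ∀ t, IsLocalMax D t → D₂ t ≤ 0 := by
    intro t ht
    by_contra! hlt
    have hmin : IsLocalMin D t := isLocalMin_of_deriv_deriv_pos (by rw [hderiv, hderiv']; exact hlt)
      ht.deriv_eq_zero hcont.continuousAt
    exact hlt.ne' (hsecond t (by
      filter_upwards [ht, hmin] with u h1 h2 using le_antisymm h1 h2))
  have hs₀ : s₀ < s := by
    by_contra! h
    exact (hpos s h).not_gt hneg
  obtain ⟨t, ht, htmin⟩ := isCompact_Icc.exists_isMinOn ⟨s, hs₀.le, hs⟩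
    (hcont.continuousOn (s := Set.Icc s₀ 0))
  have htneg : D t < 0 := lt_of_le_of_lt (htmin ⟨hs₀.le, hs⟩) hneg
  have ht1 : s₀ < t := ht.1.lt_of_ne fun h => by
    have := hpos s₀ le_rfl
    rw [h] at this; exact this.not_gt htneg
  have ht2 : t < 0 := ht.2.lt_of_ne fun h => by
    rw [h] at htneg; exact h0.not_gt htneg
  have htl : IsLocalMin D t := htmin.isLocalMin (Icc_mem_nhds ht1 ht2)
  -- A left endpoint with value below `D s₀` forces the maximum over `[u₀, t]` into the interior.
  obtain ⟨u₀, hu₀, hu₀s⟩ : ∃ u, D u < D s₀ ∧ u < s₀ :=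
    ((hlim.eventually (gt_mem_nhds (hpos s₀ le_rfl))).and (eventually_lt_atBot s₀)).exists
  obtain ⟨u, hu, humax⟩ := isCompact_Icc.exists_isMaxOn ⟨s₀, hu₀s.le, ht1.le⟩
    (hcont.continuousOn (s := Set.Icc u₀ t))
  have hub : D s₀ ≤ D u := humax ⟨hu₀s.le, ht1.le⟩
  have hu1 : u₀ < u := hu.1.lt_of_ne fun h => by
    rw [← h] at hub; exact hub.not_gt hu₀
  have hu2 : u < t := hu.2.lt_of_ne fun h => by
    rw [h] at hub; linarith [hpos s₀ le_rfl]
  have hul : IsLocalMax D u := humax.isLocalMax (Icc_mem_nhds hu1 hu2)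
  refine hcrit u t hu2 ht2 ?_ ?_ (hmax2 u hul) (hmin2 t htl)
  · rw [← hderiv]; exact hul.deriv_eq_zero
  · rw [← hderiv]; exact htl.deriv_eq_zero

/-- The numerator of the derivative vanishes at `0` and has derivative `(c² - 1) sinh(ct) sinh t <
0`. -/
lemma sinh_mul_div_sinh_strictAntiOn {c : ℝ} (hc : 0 < c) (hc1 : c < 1) :
    StrictAntiOn (fun t => Real.sinh (c * t) / Real.sinh t) (Set.Ioi 0) := by
  have hmul : ∀ t, HasDerivAt (fun t : ℝ => c * t) c t := fun t => by
    simpa using (hasDerivAt_id t).const_mul c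
  have hN : ∀ t, HasDerivAt (fun t => c * Real.cosh (c * t) * Real.sinh t
      - Real.sinh (c * t) * Real.cosh t) ((c ^ 2 - 1) * (Real.sinh (c * t) * Real.sinh t)) t := by
    intro t
    have h1 := (Real.hasDerivAt_cosh (c * t)).comp t (hmul t)
    have h2 := (Real.hasDerivAt_sinh (c * t)).comp t (hmul t)
    have := ((h1.const_mul c).mul (Real.hasDerivAt_sinh t)).sub (h2.mul (Real.hasDerivAt_cosh t))
    exact this.congr_deriv (by simp only [Function.comp]; ring)
  have hNanti : StrictAntiOn (fun t => c * Real.cosh (c * t) * Real.sinh t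
      - Real.sinh (c * t) * Real.cosh t) (Set.Ici 0) := by
    refine strictAntiOn_of_deriv_neg (convex_Ici 0) (fun t _ => (hN t).continuousAt.continuousWithinAt) ?_
    intro t ht
    rw [interior_Ici, Set.mem_Ioi] at ht
    rw [(hN t).deriv]
    have := mul_pos (Real.sinh_pos_iff.2 (mul_pos hc ht)) (Real.sinh_pos_iff.2 ht)
    exact mul_neg_of_neg_of_pos (by nlinarith) this
  have hq : ∀ t ∈ Set.Ioi (0 : ℝ), HasDerivAt (fun t => Real.sinh (c * t) / Real.sinh t)
      ((c * Real.cosh (c * t) * Real.sinh t - Real.sinh (c * t) * Real.cosh t)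
        / Real.sinh t ^ 2) t := by
    intro t ht
    have h2 := (Real.hasDerivAt_sinh (c * t)).comp t (hmul t)
    have := h2.div (Real.hasDerivAt_sinh t) (Real.sinh_pos_iff.2 ht).ne'
    exact this.congr_deriv (by simp only [Function.comp]; ring)
  refine strictAntiOn_of_deriv_neg (convex_Ioi 0)
    (fun t ht => (hq t ht).continuousAt.continuousWithinAt) ?_
  intro t ht
  rw [interior_Ioi] at ht
  rw [(hq t ht).deriv]
  have h0 := hNanti (Set.mem_Ici.2 le_rfl) (Set.mem_Ici.2 (le_of_lt ht)) ht
  simp only [mul_zero, Real.sinh_zero, Real.cosh_zero, zero_mul, sub_zero] at h0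
  exact div_neg_of_neg_of_pos h0 (pow_pos (Real.sinh_pos_iff.2 ht) 2)

lemma exp_sub_exp_div_eq_sinh_div_sinh (r s : ℝ) :
    (Real.exp s / Real.exp (r * s) - Real.exp (r * s)) / (1 - Real.exp s)
      = Real.sinh ((2 * r - 1) * (-s / 2)) / Real.sinh (-s / 2) := by
  rw [Real.sinh_eq, Real.sinh_eq, div_div_div_cancel_right₀ two_ne_zero, ← Real.exp_sub]
  rw [← mul_div_mul_left _ (Real.exp (-s / 2) - _) (Real.exp_pos (s / 2)).ne']
  simp only [mul_sub, ← Real.exp_add]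
  ring_nf
  simp [neg_add_eq_sub]

/-! ### Moments of the squared binomial coefficients. -/

/-- The `i`-th exponential moment `∑ j, (k choose j)² jⁱ eʲˢ`. -/
noncomputable def squareBinomMoment (k i : ℕ) (s : ℝ) : ℝ :=
  ∑ j ∈ Finset.range (k + 1), (k.choose j : ℝ) ^ 2 * (j : ℝ) ^ i * Real.exp (j * s)

lemma hasDerivAt_squareBinomMoment (k i : ℕ) (s : ℝ) :
    HasDerivAt (squareBinomMoment k i) (squareBinomMoment k (i + 1) s) s := by
  unfold squareBinomMoment
  refine HasDerivAt.fun_sum fun j _ => ?_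
  have h : HasDerivAt (fun s : ℝ => (j : ℝ) * s) j s := by
    simpa using (hasDerivAt_id s).const_mul (j : ℝ)
  have := (h.exp).const_mul ((k.choose j : ℝ) ^ 2 * (j : ℝ) ^ i)
  exact this.congr_deriv (by ring)

lemma squareBinomMoment_zero_pos (k : ℕ) (s : ℝ) : 0 < squareBinomMoment k 0 s := by
  unfold squareBinomMoment
  refine Finset.sum_pos (fun j hj => ?_) ⟨0, by simp⟩
  have := Nat.choose_pos (Nat.lt_succ_iff.1 (Finset.mem_range.1 hj))
  positivity

/-- The hypergeometric differential equation for `∑ j, (k choose j)² xʲ`, in the variable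
`x = eˢ`. -/
lemma squareBinomMoment_ode (k : ℕ) (s : ℝ) :
    squareBinomMoment k 2 s = Real.exp s * (squareBinomMoment k 2 s
      - 2 * k * squareBinomMoment k 1 s + k ^ 2 * squareBinomMoment k 0 s) := by
  have h : squareBinomMoment k 2 s - 2 * k * squareBinomMoment k 1 s
      + k ^ 2 * squareBinomMoment k 0 s = ∑ j ∈ Finset.range (k + 1),
        (k.choose j : ℝ) ^ 2 * ((k : ℝ) - j) ^ 2 * Real.exp (j * s) := by
    unfold squareBinomMoment
    rw [Finset.mul_sum, Finset.mul_sum, ← Finset.sum_sub_distrib, ← Finset.sum_add_distrib]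
    exact Finset.sum_congr rfl fun j _ => by ring
  -- The terms `j = k` on the right and `j = 0` on the left vanish; the rest match after the shift
  -- `j ↦ j + 1`, by `(j+1) C(k,j+1) = (k-j) C(k,j)`.
  rw [h, Finset.sum_range_succ]
  conv_lhs => rw [squareBinomMoment, Finset.sum_range_succ']
  simp only [sub_self, Nat.cast_zero]
  rw [show ((0 : ℝ)) ^ 2 = 0 by norm_num, mul_zero, zero_mul, mul_zero, zero_mul, add_zero, add_zero,
    Finset.mul_sum]
  refine Finset.sum_congr rfl fun j hj => ?_
  have hj := (Finset.mem_range.1 hj).le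
  have hc : (k.choose (j + 1) : ℝ) * ((j + 1 : ℕ) : ℝ) = k.choose j * ((k : ℝ) - j) := by
    have := Nat.choose_succ_right_eq k j
    rw [← Nat.cast_sub hj]
    exact_mod_cast this
  rw [← mul_pow, ← mul_pow, hc, Nat.cast_succ, add_mul, one_mul, Real.exp_add]
  ring

open Filter Topology in
lemma squareBinomMoment_tendsto_atBot (k : ℕ) :
    Tendsto (squareBinomMoment k 0) atBot (𝓝 1) := by
  have h : ∀ s, squareBinomMoment k 0 s
      = ∑ j ∈ Finset.range (k + 1), (k.choose j : ℝ) ^ 2 * Real.exp s ^ j := by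
    intro s
    simp [squareBinomMoment, Real.exp_nat_mul]
  have hc : Continuous fun x : ℝ => ∑ j ∈ Finset.range (k + 1), (k.choose j : ℝ) ^ 2 * x ^ j := by
    fun_prop
  have := (hc.tendsto 0).comp Real.tendsto_exp_atBot
  rw [Finset.sum_range_succ'] at this
  simpa [Function.comp_def, ← h] using this

lemma squareBinomMoment_at_zero (k : ℕ) : squareBinomMoment k 0 0 = (2 * k).choose k := by
  simp only [squareBinomMoment, pow_zero, mul_one, mul_zero, Real.exp_zero]
  exact_mod_cast Nat.sum_range_choose_sq k

/-- For `s ≤ 0` and `j ≥ 1`, `eʲˢ ≤ eˢ`. This controls the sum near `-∞`. -/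
lemma squareBinomMoment_le_one_add (k : ℕ) {s : ℝ} (hs : s ≤ 0) :
    squareBinomMoment k 0 s ≤ 1 + (2 * k).choose k * Real.exp s := by
  rw [← squareBinomMoment_at_zero]
  simp only [squareBinomMoment]
  rw [Finset.sum_range_succ', Finset.sum_range_succ', add_mul, Finset.sum_mul]
  have : ∑ j ∈ Finset.range k, (k.choose (j + 1) : ℝ) ^ 2 * ((j + 1 : ℕ) : ℝ) ^ 0
        * Real.exp (((j + 1 : ℕ) : ℝ) * s)
      ≤ ∑ j ∈ Finset.range k, (k.choose (j + 1) : ℝ) ^ 2 * ((j + 1 : ℕ) : ℝ) ^ 0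
        * Real.exp (((j + 1 : ℕ) : ℝ) * 0) * Real.exp s := by
    refine Finset.sum_le_sum fun j _ => ?_
    simp only [mul_zero, Real.exp_zero, mul_one]
    refine mul_le_mul_of_nonneg_left (Real.exp_le_exp.2 ?_) (by positivity)
    push_cast
    nlinarith [(Nat.cast_nonneg j : (0 : ℝ) ≤ j)]
  simp only [Nat.choose_zero_right, Nat.cast_zero, zero_mul, Real.exp_zero, pow_zero, Nat.cast_one,
    one_pow, mul_one] at this ⊢
  linarith [Real.exp_pos s]

/-! ### Bounds `k < p_k < 2k`, that is `1/2 < r < 1`. -/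

lemma two_pow_lt_choose {k : ℕ} (hk : 2 ≤ k) : 2 ^ k < (2 * k).choose k := by
  rw [← Nat.centralBinom_eq_two_mul_choose]
  induction k, hk using Nat.le_induction with
  | base => decide
  | succ n hn ih =>
    have h := Nat.succ_mul_centralBinom_succ n
    have h2 : (n + 1) * 2 ^ (n + 1) < (n + 1) * (n + 1).centralBinom := by
      rw [h, pow_succ]; nlinarith
    exact lt_of_mul_lt_mul_left h2 (Nat.zero_le _)

lemma two_rpow_criticalExponent (k : ℕ) : (2 : ℝ) ^ criticalExponent k = (2 * k).choose k :=
  Real.rpow_logb two_pos (by norm_num)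
    (by exact_mod_cast Nat.choose_pos (by omega))

lemma lt_criticalExponent {k : ℕ} (hk : 2 ≤ k) : (k : ℝ) < criticalExponent k := by
  rw [criticalExponent, Real.lt_logb_iff_rpow_lt one_lt_two
    (by exact_mod_cast Nat.choose_pos (by omega)), Real.rpow_natCast]
  exact_mod_cast two_pow_lt_choose hk

lemma criticalExponent_lt {k : ℕ} (hk : 0 < k) : criticalExponent k < 2 * k := by
  rw [criticalExponent, Real.logb_lt_iff_lt_rpow one_lt_two
    (by exact_mod_cast Nat.choose_pos (by omega)), Real.rpow_mul two_pos.le, Real.rpow_natCast]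
  norm_num
  rw [← Nat.centralBinom_eq_two_mul_choose]
  exact_mod_cast Nat.centralBinom_lt_four_pow hk.ne'

lemma criticalExponent_pos {k : ℕ} (hk : 0 < k) : 0 < criticalExponent k := by
  refine Real.logb_pos one_lt_two ?_
  rw [← Nat.centralBinom_eq_two_mul_choose]
  exact_mod_cast Nat.two_le_centralBinom k hk

lemma criticalExponent_one : criticalExponent 1 = 1 := by
  simp [criticalExponent]

/-! ### The polynomial inequality. -/

/-- The second derivative test quantity for `p log (1 + eʳˢ) - log ∑ j, (k choose j)² eʲˢ` at a
critical point. Here `x = eˢ`, `y = eʳˢ` and `A, B, C` are the moments of order `0, 1, 2`. -/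
lemma critical_point_identity {k r x y A B C : ℝ} (hy : 0 < y) (hA : 0 < A) (hx : x < 1)
    (hode : C = x * (C - 2 * k * B + k ^ 2 * A)) (hcrit : k * (y / (1 + y)) - B / A = 0) :
    k * (r * y / (1 + y) ^ 2) - (C * A - B * B) / A ^ 2
      = k * y / (1 + y) ^ 2 * (r - k * ((x / y - y) / (1 - x))) := by
  have hx' : 1 - x ≠ 0 := by linarith
  have hy' : 1 + y ≠ 0 := by positivity
  have hB : B = k * (y / (1 + y)) * A := by
    field_simp at hcrit ⊢
    linarith
  have hC : C = x * (k ^ 2 * A - 2 * k * B) / (1 - x) := by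
    rw [eq_div_iff hx']; linarith
  rw [hC, hB]
  field_simp
  ring

open Filter Topology in
theorem squareBinomMoment_le_rpow {k : ℕ} (hk : 0 < k) {s : ℝ} (hs : s ≤ 0) :
    squareBinomMoment k 0 s
      ≤ (1 + Real.exp (k / criticalExponent k * s)) ^ criticalExponent k := by
  -- For `k = 1` both sides coincide and `r = 1`, so the strict argument needs `k ≥ 2`.
  rcases (Nat.succ_le_of_lt hk).eq_or_lt with rfl | hk2
  · simp [criticalExponent_one, squareBinomMoment, Finset.sum_range_succ]
  have hp := criticalExponent_pos hk
  have hkp := lt_criticalExponent hk2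
  have hpk := criticalExponent_lt hk
  have h2p := two_rpow_criticalExponent k
  set p := criticalExponent k with hpdef
  set r := (k : ℝ) / p with hrdef
  have hk0 : (0 : ℝ) < k := by exact_mod_cast hk
  have hr1 : r < 1 := (div_lt_one hp).2 hkp
  have hr2 : 0 < 2 * r - 1 := by
    rw [hrdef, sub_pos, ← mul_div_assoc, lt_div_iff₀ hp]; linarith
  have hr0 : 0 < r := by linarith
  have hpr : p * r = k := mul_div_cancel₀ _ hp.ne'
  have hA := squareBinomMoment_zero_pos k
  have hE : ∀ s, 0 < 1 + Real.exp (r * s) := fun s => by positivity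
  have hexp : ∀ s, HasDerivAt (fun s => Real.exp (r * s)) (r * Real.exp (r * s)) s := fun s => by
    have h : HasDerivAt (fun s : ℝ => r * s) r s := by
      simpa using (hasDerivAt_id s).const_mul r
    simpa [mul_comm] using h.exp
  set D : ℝ → ℝ := fun s =>
    p * Real.log (1 + Real.exp (r * s)) - Real.log (squareBinomMoment k 0 s) with hDdef
  have hD : ∀ s, HasDerivAt D (k * (Real.exp (r * s) / (1 + Real.exp (r * s)))
      - squareBinomMoment k 1 s / squareBinomMoment k 0 s) s := by
    intro s
    have h1 := ((((hexp s).const_add 1).log (hE s).ne').const_mul p).sub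
      ((hasDerivAt_squareBinomMoment k 0 s).log (hA s).ne')
    exact h1.congr_deriv (by rw [← hpr]; ring)
  have hD₁ : ∀ s, HasDerivAt (fun s => k * (Real.exp (r * s) / (1 + Real.exp (r * s)))
      - squareBinomMoment k 1 s / squareBinomMoment k 0 s)
      (k * (r * Real.exp (r * s) / (1 + Real.exp (r * s)) ^ 2)
        - (squareBinomMoment k 2 s * squareBinomMoment k 0 s
          - squareBinomMoment k 1 s * squareBinomMoment k 1 s)
          / squareBinomMoment k 0 s ^ 2) s := by
    intro s
    have h1 := (((hexp s).div ((hexp s).const_add 1) (hE s).ne').const_mul (k : ℝ)).sub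
      ((hasDerivAt_squareBinomMoment k 1 s).div (hasDerivAt_squareBinomMoment k 0 s) (hA s).ne')
    exact h1.congr_deriv (by ring)
  have hexp0 : Tendsto (fun s => Real.exp (r * s)) atBot (𝓝 0) :=
    Real.tendsto_exp_atBot.comp (tendsto_id.const_mul_atBot hr0)
  have hlim : Tendsto D atBot (𝓝 0) := by
    have h1 := ((hexp0.const_add 1).log (by norm_num)).const_mul p
    have h2 := (squareBinomMoment_tendsto_atBot k).log one_ne_zero
    simpa using h1.sub h2
  have hC : (0 : ℝ) < (2 * k).choose k := by rw [← h2p]; positivity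
  -- Bernoulli gives `(1 + e^{rs})^p ≥ 1 + p e^{rs}`, which beats `1 + C(2k,k) eˢ` once `e^{(1-r)s}
  -- < p / C(2k,k)`.
  obtain ⟨s₀, hs₀⟩ : ∃ s₀, ∀ s ≤ s₀, 0 < D s := by
    have h1 : Tendsto (fun s => Real.exp ((1 - r) * s)) atBot (𝓝 0) :=
      Real.tendsto_exp_atBot.comp (tendsto_id.const_mul_atBot (by linarith))
    have h2 := (h1.eventually (gt_mem_nhds (div_pos hp hC))).and (eventually_le_atBot 0)
    obtain ⟨s₀, h⟩ := eventually_atBot.1 h2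
    refine ⟨s₀, fun s hs => ?_⟩
    obtain ⟨h3, h4⟩ := h s hs
    rw [lt_div_iff₀ hC] at h3
    have h5 : squareBinomMoment k 0 s < (1 + Real.exp (r * s)) ^ p := by
      refine (squareBinomMoment_le_one_add k h4).trans_lt (lt_of_lt_of_le ?_
        (one_add_mul_self_le_rpow_one_add (by linarith [Real.exp_pos (r * s)])
          (by linarith [(by exact_mod_cast hk : (1 : ℝ) ≤ k)])))
      have h6 : Real.exp s = Real.exp ((1 - r) * s) * Real.exp (r * s) := by
        rw [← Real.exp_add]; ring_nf
      rw [h6]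
      have := mul_lt_mul_of_pos_right h3 (Real.exp_pos (r * s))
      linarith
    have := Real.log_lt_log (hA s) h5
    rw [Real.log_rpow (hE s)] at this
    exact sub_pos.2 this
  have h0 : 0 ≤ D 0 := by
    have : D 0 = 0 := by
      simp only [hDdef, mul_zero, Real.exp_zero, squareBinomMoment_at_zero]
      rw [← h2p, Real.log_rpow two_pos]
      norm_num
    exact this.ge
  have hcrit : 0 ≤ D s := by
    refine nonneg_of_no_max_before_min hD hD₁ h0 hlim hs₀ ?_ hs
    intro u t hut ht0 hu1 ht1 hu2 ht2
    rw [critical_point_identity (Real.exp_pos _) (hA u) (Real.exp_lt_one_iff.2 (hut.trans ht0))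
      (squareBinomMoment_ode k u) hu1, exp_sub_exp_div_eq_sinh_div_sinh] at hu2
    rw [critical_point_identity (Real.exp_pos _) (hA t) (Real.exp_lt_one_iff.2 ht0)
      (squareBinomMoment_ode k t) ht1, exp_sub_exp_div_eq_sinh_div_sinh] at ht2
    have hc : ∀ s, 0 < k * Real.exp (r * s) / (1 + Real.exp (r * s)) ^ 2 := fun s => by positivity
    have hu3 := nonpos_of_mul_nonpos_right hu2 (hc u)
    have ht3 := nonneg_of_mul_nonneg_right ht2 (hc t)
    have hanti := sinh_mul_div_sinh_strictAntiOn hr2 (by linarith)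
      (show (-t / 2) ∈ Set.Ioi (0 : ℝ) by simp only [Set.mem_Ioi]; linarith)
      (show (-u / 2) ∈ Set.Ioi (0 : ℝ) by simp only [Set.mem_Ioi]; linarith)
      (by linarith)
    have := mul_lt_mul_of_pos_left hanti hk0
    simp only at this
    linarith
  rw [← Real.log_le_log_iff (hA s) (by positivity), Real.log_rpow (hE s)]
  exact sub_nonneg.1 hcrit

/-- Both sides are homogeneous of degree `k`; divide by `yᵏ` and put `s = log (x/y)`. -/
lemma sum_choose_sq_le_of_le {k : ℕ} (hk : 0 < k) {x y : ℝ} (hx : 0 < x) (hxy : x ≤ y) :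
    ∑ j ∈ Finset.range (k + 1), (k.choose j : ℝ) ^ 2 * x ^ j * y ^ (k - j)
      ≤ (x ^ (k / criticalExponent k) + y ^ (k / criticalExponent k)) ^ criticalExponent k := by
  have hp := criticalExponent_pos hk
  have hy := hx.trans_le hxy
  have h := squareBinomMoment_le_rpow hk (s := Real.log (x / y))
    (Real.log_nonpos (by positivity) ((div_le_one hy).2 hxy))
  rw [mul_comm _ (Real.log _), ← Real.rpow_def_of_pos (div_pos hx hy)] at h
  have hl : ∑ j ∈ Finset.range (k + 1), (k.choose j : ℝ) ^ 2 * x ^ j * y ^ (k - j)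
      = y ^ k * squareBinomMoment k 0 (Real.log (x / y)) := by
    rw [squareBinomMoment, Finset.mul_sum]
    refine Finset.sum_congr rfl fun j hj => ?_
    rw [Real.exp_nat_mul, Real.exp_log (div_pos hx hy), div_pow,
      ← pow_sub_mul_pow y (Nat.lt_succ_iff.1 (Finset.mem_range.1 hj))]
    field_simp
  have hrr : x ^ (k / criticalExponent k) + y ^ (k / criticalExponent k)
      = y ^ (k / criticalExponent k) * (1 + (x / y) ^ (k / criticalExponent k)) := by
    have := Real.rpow_pos_of_pos hy (k / criticalExponent k)
    rw [Real.div_rpow hx.le hy.le]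
    field_simp
    ring
  rw [hl, hrr, Real.mul_rpow (by positivity) (by positivity), ← Real.rpow_mul hy.le,
    div_mul_cancel₀ _ hp.ne', Real.rpow_natCast]
  exact mul_le_mul_of_nonneg_left h (by positivity)

theorem sum_choose_sq_le {k : ℕ} (hk : 0 < k) {x y : ℝ} (hx : 0 ≤ x) (hy : 0 ≤ y) :
    ∑ j ∈ Finset.range (k + 1), (k.choose j : ℝ) ^ 2 * x ^ j * y ^ (k - j)
      ≤ (x ^ (k / criticalExponent k) + y ^ (k / criticalExponent k)) ^ criticalExponent k := by
  wlog hxy : x ≤ y generalizing x y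
  · have h := this hy hx (le_of_not_ge hxy)
    rw [add_comm (x ^ _)]
    refine le_of_eq_of_le ?_ h
    rw [← Finset.sum_range_reflect]
    refine Finset.sum_congr rfl fun j hj => ?_
    have hj := Nat.lt_succ_iff.1 (Finset.mem_range.1 hj)
    rw [show k + 1 - 1 - j = k - j by omega, Nat.choose_symm hj, Nat.sub_sub_self hj]
    ring
  have hp := criticalExponent_pos hk
  rcases hx.eq_or_lt with rfl | hx
  · have hk0 : (k : ℝ) / criticalExponent k ≠ 0 := by positivity
    rw [Finset.sum_range_succ', Real.zero_rpow hk0, zero_add, ← Real.rpow_mul hy,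
      div_mul_cancel₀ _ hp.ne', Real.rpow_natCast]
    simp
  · exact sum_choose_sq_le_of_le hk hx hxy

/-! ### The law of the walk through Laurent polynomials. -/

open LaurentPolynomial in
/-- The step generating function `a T + 1/2 + b T⁻¹`. -/
noncomputable def stepLaurent (a b : ℝ) : LaurentPolynomial ℝ :=
  .single 1 a + .single 0 (1 / 2) + .single (-1) b

lemma coeff_mul_stepLaurent (f : LaurentPolynomial ℝ) (a b : ℝ) (m : ℤ) :
    (f * stepLaurent a b).coeff m
      = f.coeff (m - 1) * a + f.coeff m * (1 / 2) + f.coeff (m + 1) * b := by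
  simp only [stepLaurent, mul_add, AddMonoidAlgebra.coeff_add, Finsupp.add_apply,
    AddMonoidAlgebra.coeff_mul_single_apply, sub_eq_add_neg, neg_zero, add_zero, neg_neg]

lemma stepLaurent_eq_mul {x y : ℝ} (hxy : x + y = 1) :
    stepLaurent (x / 2) (y / 2) = .single 0 (1 / 2) *
      ((.single 1 x + .single 0 y) * (.single 0 1 + .single (-1) 1)) := by
  have hsplit : (.single 0 (1 / 2) : LaurentPolynomial ℝ)
      = .single 0 (1 / 2 * x) + .single 0 (1 / 2 * y) := by
    rw [← AddMonoidAlgebra.single_add, ← mul_add, hxy, mul_one]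
  simp only [stepLaurent, mul_add, add_mul, AddMonoidAlgebra.single_mul_single, zero_add, add_zero,
    mul_one, add_neg_cancel]
  rw [hsplit, show x / 2 = 1 / 2 * x by ring, show y / 2 = 1 / 2 * y by ring]
  abel

lemma single_add_single_zero_pow (m : ℤ) (x y : ℝ) (k : ℕ) :
    (.single m x + .single 0 y : LaurentPolynomial ℝ) ^ k = ∑ i ∈ Finset.range (k + 1),
      .single (i * m) ((k.choose i : ℝ) * x ^ i * y ^ (k - i)) := by
  rw [add_pow]
  refine Finset.sum_congr rfl fun i _ => ?_
  rw [AddMonoidAlgebra.single_pow, AddMonoidAlgebra.single_pow, AddMonoidAlgebra.single_mul_single,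
    AddMonoidAlgebra.natCast_def, AddMonoidAlgebra.single_mul_single]
  congr 1
  · simp
  · ring

/-- In `(xT + y)ᵏ (1 + T⁻¹)ᵏ` the constant term pairs `Tʲ` with `T⁻ʲ`, whence the squared binomials.
-/
lemma coeff_zero_stepLaurent_pow {x y : ℝ} (hxy : x + y = 1) (k : ℕ) :
    (stepLaurent (x / 2) (y / 2) ^ k).coeff 0 = (1 / 2) ^ k *
      ∑ j ∈ Finset.range (k + 1), (k.choose j : ℝ) ^ 2 * x ^ j * y ^ (k - j) := by
  rw [stepLaurent_eq_mul hxy, mul_pow, mul_pow, single_add_single_zero_pow,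
    add_comm (AddMonoidAlgebra.single 0 1), single_add_single_zero_pow, Finset.sum_mul_sum,
    AddMonoidAlgebra.single_pow, smul_zero, AddMonoidAlgebra.coeff_single_zero_mul]
  congr 1
  simp only [AddMonoidAlgebra.single_mul_single, AddMonoidAlgebra.coeff_sum, Finsupp.coe_finsetSum,
    Finset.sum_apply, AddMonoidAlgebra.coeff_single, Finsupp.single_apply]
  refine Finset.sum_congr rfl fun i hi => ?_
  rw [Finset.sum_eq_single_of_mem i hi]
  · rw [if_pos (by ring)]
    ring
  · intro j _ hj
    rw [if_neg (by omega)]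

section Walk
variable {Ω : Type u} [MeasurableSpace Ω] {μ : Measure Ω} {X : ℕ → Ω → ℤ}

lemma measureReal_sum_succ_eq [IsProbabilityMeasure μ] (hm : ∀ i, Measurable (X i)) (hind : iIndepFun X μ)
    (hid : ∀ i, IdentDistrib (X i) (X 0) μ μ) (hX : ∀ i ω, X i ω = -1 ∨ X i ω = 0 ∨ X i ω = 1)
    (n : ℕ) (m : ℤ) :
    μ.real {ω | ∑ i ∈ Finset.range (n + 1), X i ω = m}
      = μ.real {ω | ∑ i ∈ Finset.range n, X i ω = m - 1} * μ.real {ω | X 0 ω = 1}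
        + μ.real {ω | ∑ i ∈ Finset.range n, X i ω = m} * μ.real {ω | X 0 ω = 0}
        + μ.real {ω | ∑ i ∈ Finset.range n, X i ω = m + 1} * μ.real {ω | X 0 ω = -1} := by
  have hS : Measurable fun ω => ∑ i ∈ Finset.range n, X i ω :=
    Finset.measurable_fun_sum _ fun i _ => hm i
  have hprod : ∀ c d : ℤ, μ.real ({ω | ∑ i ∈ Finset.range n, X i ω = c} ∩ {ω | X n ω = d})
      = μ.real {ω | ∑ i ∈ Finset.range n, X i ω = c} * μ.real {ω | X 0 ω = d} := by
    intro c d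
    have h := (hind.indepFun_finsetSum_of_notMem hm
      (Finset.notMem_range_self (n := n))).measure_inter_preimage_eq_mul {c} {d}
      (measurableSet_singleton c) (measurableSet_singleton d)
    have h' := (hid n).measure_mem_eq (measurableSet_singleton d)
    rw [h'] at h
    have e : (∑ j ∈ Finset.range n, X j) ⁻¹' {c} = {ω | ∑ i ∈ Finset.range n, X i ω = c} := by
      ext ω; simp
    rw [e] at h
    simp only [Measure.real, ← ENNReal.toReal_mul]
    exact congrArg ENNReal.toReal h
  have hms : ∀ c d : ℤ, MeasurableSet
      ({ω | ∑ i ∈ Finset.range n, X i ω = c} ∩ {ω | X n ω = d}) := fun c d =>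
    (hS (measurableSet_singleton c)).inter (hm n (measurableSet_singleton d))
  rw [← hprod, ← hprod, ← hprod, ← measureReal_union _ (hms _ _), ← measureReal_union _ (hms _ _)]
  · congr 1
    ext ω
    simp only [Finset.sum_range_succ, Set.mem_ofPred_eq, Set.mem_union, Set.mem_inter_iff]
    rcases hX n ω with h | h | h <;> rw [h] <;> constructor <;> intro h2 <;> omega
  · rw [Set.disjoint_left]
    rintro ω (⟨-, h⟩ | ⟨-, h⟩) ⟨-, h'⟩ <;> simp only [Set.mem_ofPred_eq] at h h' <;> omega
  · rw [Set.disjoint_left]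
    rintro ω ⟨-, h⟩ ⟨-, h'⟩
    simp only [Set.mem_ofPred_eq] at h h'; omega

lemma measureReal_sum_eq_coeff [IsProbabilityMeasure μ] (hm : ∀ i, Measurable (X i)) (hind : iIndepFun X μ)
    (hid : ∀ i, IdentDistrib (X i) (X 0) μ μ) (hX : ∀ i ω, X i ω = -1 ∨ X i ω = 0 ∨ X i ω = 1)
    (hlazy : μ.real {ω | X 0 ω = 0} = 1 / 2) (n : ℕ) (m : ℤ) :
    μ.real {ω | ∑ i ∈ Finset.range n, X i ω = m}
      = (stepLaurent (μ.real {ω | X 0 ω = 1}) (μ.real {ω | X 0 ω = -1}) ^ n).coeff m := by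
  induction n generalizing m with
  | zero =>
    by_cases h : m = 0
    · subst h; simp
    · rw [pow_zero, AddMonoidAlgebra.one_def, AddMonoidAlgebra.coeff_single, Finsupp.single_apply,
        if_neg (Ne.symm h)]
      simp [Ne.symm h]
  | succ n ih =>
    rw [measureReal_sum_succ_eq hm hind hid hX, ih, ih, ih, pow_succ, coeff_mul_stepLaurent, hlazy]

/-- Meant for the extreme values `m = ±n`, reached only when all steps agree. -/
lemma measureReal_sum_eq_pow (hind : iIndepFun X μ)
    (hid : ∀ i, IdentDistrib (X i) (X 0) μ μ) {c : ℤ} {n : ℕ} {m : ℤ}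
    (h : ∀ ω, ∑ i ∈ Finset.range n, X i ω = m ↔ ∀ i ∈ Finset.range n, X i ω = c) :
    μ.real {ω | ∑ i ∈ Finset.range n, X i ω = m} = μ.real {ω | X 0 ω = c} ^ n := by
  have h1 := hind.measure_inter_preimage_eq_mul (Finset.range n) (sets := fun _ => {c})
    (fun _ _ => measurableSet_singleton c)
  have e : {ω | ∑ i ∈ Finset.range n, X i ω = m} = ⋂ i ∈ Finset.range n, X i ⁻¹' {c} := by
    ext ω; simp [h]
  have h2 : ∀ i ∈ Finset.range n, μ (X i ⁻¹' {c}) = μ (X 0 ⁻¹' {c}) := fun i _ =>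
    (hid i).measure_mem_eq (measurableSet_singleton c)
  rw [Finset.prod_congr rfl h2, Finset.prod_const, Finset.card_range] at h1
  rw [Measure.real, e, h1, ENNReal.toReal_pow]
  rfl

end Walk

/-- The laws of a lazy simple random walk at `-k`, `0` and `k`, with `x / 2` and `y / 2` the
probabilities of the steps `1` and `-1`. -/
lemma IsLazySimpleRandomWalk.exists_law {Ω : Type u} [MeasurableSpace Ω] {μ : Measure Ω}
    [IsProbabilityMeasure μ] {S : ℕ → Ω → ℤ} (hS : IsLazySimpleRandomWalk μ S) :
    ∃ x y : ℝ, 0 ≤ x ∧ 0 ≤ y ∧ x + y = 1 ∧ ∀ k,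
      μ.real {ω | S k ω = 0} = (1 / 2) ^ k *
        ∑ j ∈ Finset.range (k + 1), (k.choose j : ℝ) ^ 2 * x ^ j * y ^ (k - j) ∧
      μ.real {ω | S k ω = -(k : ℤ)} = (y / 2) ^ k ∧ μ.real {ω | S k ω = (k : ℤ)} = (x / 2) ^ k := by
  obtain ⟨X, hm, hind, hid, hX, hlazy, hsum⟩ := hS
  have hlazy' : μ.real {ω | X 0 ω = 0} = 1 / 2 := by simp [Measure.real, hlazy]
  have hone : μ.real {ω | X 0 ω = 1} + μ.real {ω | X 0 ω = -1} = 1 / 2 := by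
    have hu : ({ω | X 0 ω = 1} ∪ {ω | X 0 ω = -1}) = {ω | X 0 ω = 0}ᶜ := by
      ext ω
      simp only [Set.mem_union, Set.mem_ofPred_eq, Set.mem_compl_iff]
      rcases hX 0 ω with h | h | h <;> rw [h] <;> omega
    rw [← measureReal_union ?_ (show MeasurableSet {ω | X 0 ω = -1} from
      hm 0 (measurableSet_singleton (-1))), hu,
      probReal_compl_eq_one_sub (show MeasurableSet {ω | X 0 ω = 0} from
        hm 0 (measurableSet_singleton 0)), hlazy']
    · norm_num
    · rw [Set.disjoint_left]
      intro ω h h'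
      simp only [Set.mem_ofPred_eq] at h h'; omega
  refine ⟨2 * μ.real {ω | X 0 ω = 1}, 2 * μ.real {ω | X 0 ω = -1}, by positivity, by positivity,
    by linarith, fun k => ⟨?_, ?_, ?_⟩⟩
  · rw [← coeff_zero_stepLaurent_pow (by linarith), mul_div_cancel_left₀ _ two_ne_zero,
      mul_div_cancel_left₀ _ two_ne_zero, ← measureReal_sum_eq_coeff hm hind hid hX hlazy']
    simp only [hsum]
  · rw [mul_div_cancel_left₀ _ two_ne_zero]
    simp only [hsum]
    refine measureReal_sum_eq_pow hind hid fun ω => ?_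
    have := Finset.sum_eq_sum_iff_of_le (s := Finset.range k) (f := fun _ => (-1 : ℤ))
      (g := fun i => X i ω) (fun i _ => by rcases hX i ω with h | h | h <;> omega)
    rw [Finset.sum_const, Finset.card_range, nsmul_eq_mul, mul_neg_one] at this
    simpa only [eq_comm] using this
  · rw [mul_div_cancel_left₀ _ two_ne_zero]
    simp only [hsum]
    refine measureReal_sum_eq_pow hind hid fun ω => ?_
    have := Finset.sum_eq_sum_iff_of_le (s := Finset.range k) (f := fun i => X i ω)
      (g := fun _ => (1 : ℤ)) (fun i _ => by rcases hX i ω with h | h | h <;> omega)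
    rwa [Finset.sum_const, Finset.card_range, nsmul_eq_mul, mul_one] at this

/-! ### The symmetric walk and the conclusion. -/

/-- There is a symmetric lazy simple random walk in every universe. -/
lemma exists_symmetric_isLazySimpleRandomWalk :
    ∃ (Ω : Type u) (_ : MeasurableSpace Ω) (μ : Measure Ω) (_ : IsProbabilityMeasure μ)
      (S : ℕ → Ω → ℤ), IsLazySimpleRandomWalk μ S ∧ μ.real {ω | S 1 ω = 1} = 1 / 4 := by
  -- Four equally likely atoms, two of them mapped to `0`, give step weights `1/2, 1/4, 1/4`.
  let g : ULift.{u} (Fin 4) → ℤ := fun i => ![0, 0, 1, -1] i.down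
  let ν : Measure (ULift.{u} (Fin 4)) := uniformOn Set.univ
  have : IsProbabilityMeasure ν :=
    isProbabilityMeasure_uniformOn Set.finite_univ Set.univ_nonempty
  have hg : Measurable g := measurable_of_finite g
  let μ := Measure.infinitePi fun _ : ℕ => ν
  have hν : ∀ i (s : Set (ULift.{u} (Fin 4))), μ (Function.eval i ⁻¹' s) = ν s := fun i s =>
    (measurePreserving_eval_infinitePi (fun _ : ℕ => ν) i).measure_preimage
      (Set.toFinite s).measurableSet.nullMeasurableSet
  have hcount : ∀ (s : Finset (ULift.{u} (Fin 4))), ν s = s.card / 4 := fun s => by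
    simp only [ν, uniformOn_univ]
    rw [Measure.count_apply_finset]
    simp
  refine ⟨ℕ → ULift.{u} (Fin 4), inferInstance, μ, inferInstance,
    fun n ω => ∑ i ∈ Finset.range n, g (ω i), ⟨fun i ω => g (ω i), fun i => by fun_prop,
    iIndepFun_infinitePi fun _ => hg, fun i => ?_, fun i ω => ?_, ?_, fun _ _ => rfl⟩, ?_⟩
  · refine IdentDistrib.comp (u := g) ⟨(measurable_pi_apply i).aemeasurable,
      (measurable_pi_apply 0).aemeasurable, ?_⟩ hg
    exact (Measure.infinitePi_map_eval (fun _ : ℕ => ν) i).trans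
      (Measure.infinitePi_map_eval (fun _ : ℕ => ν) 0).symm
  · change g (ω i) = -1 ∨ g (ω i) = 0 ∨ g (ω i) = 1
    obtain ⟨j⟩ := ω i
    fin_cases j <;> simp [g]
  · have h := (hν 0 _).trans (hcount {⟨0⟩, ⟨1⟩})
    have e : {ω : ℕ → ULift.{u} (Fin 4) | g (ω 0) = 0}
        = Function.eval 0 ⁻¹' (({⟨0⟩, ⟨1⟩} : Finset (ULift.{u} (Fin 4))) : Set _) := by
      ext ω
      simp only [Set.mem_ofPred_eq, Set.mem_preimage, Function.eval]
      obtain ⟨j⟩ := ω 0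
      fin_cases j <;> simp [g]
    rw [e, h, Finset.card_pair (by simp), Nat.cast_two,
      ENNReal.div_eq_div_iff (by simp) (by simp) (by simp) (by simp)]
    norm_num
  · have h := (hν 0 _).trans (hcount {⟨2⟩})
    have e : {ω : ℕ → ULift.{u} (Fin 4) | ∑ i ∈ Finset.range 1, g (ω i) = 1}
        = Function.eval 0 ⁻¹' (({⟨2⟩} : Finset (ULift.{u} (Fin 4))) : Set _) := by
      ext ω
      simp only [Set.mem_ofPred_eq, Set.mem_preimage, Function.eval, Finset.sum_range_one]
      obtain ⟨j⟩ := ω 0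
      fin_cases j <;> simp [g]
    rw [e, Measure.real, h]
    simp

theorem corollary3 (k : ℕ) (hk : 0 < k) :
    IsLeast
      {p : ℝ | 0 < p ∧
        ∀ (Ω : Type u) [MeasurableSpace Ω] (μ : Measure Ω) [IsProbabilityMeasure μ]
          (S : ℕ → Ω → ℤ), IsLazySimpleRandomWalk μ S →
            (μ.real {ω | S k ω = 0}) ^ (1 / p) ≤
              (μ.real {ω | S k ω = -(k : ℤ)}) ^ (1 / p) +
                (μ.real {ω | S k ω = (k : ℤ)}) ^ (1 / p)}
      (criticalExponent k) := by
  have hp := criticalExponent_pos hk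
  refine ⟨⟨hp, ?_⟩, ?_⟩
  · intro Ω _ μ _ S hS
    obtain ⟨x, y, hx, hy, -, hlaw⟩ := hS.exists_law
    obtain ⟨h0, hneg, hpos⟩ := hlaw k
    rw [h0, hneg, hpos]
    have hpow : ∀ z : ℝ, 0 ≤ z → ((z / 2) ^ k) ^ (1 / criticalExponent k)
        = ((1 / 2 : ℝ) ^ k) ^ (1 / criticalExponent k) * z ^ (k / criticalExponent k) := by
      intro z hz
      rw [div_eq_mul_one_div z 2, mul_pow, mul_comm, Real.mul_rpow (by positivity) (by positivity),
        ← Real.rpow_natCast z, ← Real.rpow_mul hz, mul_one_div]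
    rw [hpow x hx, hpow y hy, ← mul_add, Real.mul_rpow (by positivity) (by positivity)]
    refine mul_le_mul_of_nonneg_left ?_ (by positivity)
    rw [one_div, Real.rpow_inv_le_iff_of_pos (by positivity) (by positivity) hp, add_comm (y ^ _)]
    exact sum_choose_sq_le hk hx hy
  · rintro p ⟨hp0, hall⟩
    obtain ⟨Ω, _, μ, _, S, hS, h1⟩ := exists_symmetric_isLazySimpleRandomWalk.{u}
    have h := hall Ω μ S hS
    obtain ⟨x, y, hx, hy, hxy, hlaw⟩ := hS.exists_law
    have hx2 := (hlaw 1).2.2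
    rw [Nat.cast_one, h1, pow_one] at hx2
    obtain rfl : x = 1 / 2 := by linarith
    obtain rfl : y = 1 / 2 := by linarith
    obtain ⟨h0, hneg, hpos⟩ := hlaw k
    have hsum : ∑ j ∈ Finset.range (k + 1), (k.choose j : ℝ) ^ 2 * (1 / 2) ^ j * (1 / 2) ^ (k - j)
        = (1 / 2 : ℝ) ^ k * (2 * k).choose k := by
      rw [← squareBinomMoment_at_zero, squareBinomMoment, Finset.mul_sum]
      refine Finset.sum_congr rfl fun j hj => ?_
      rw [mul_assoc, pow_mul_pow_sub _ (Nat.lt_succ_iff.1 (Finset.mem_range.1 hj))]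
      simp [mul_comm]
    rw [h0, hneg, hpos, hsum, ← mul_assoc, ← mul_pow, div_eq_mul_one_div (1 / 2 : ℝ) 2,
      Real.mul_rpow (by positivity) (by positivity), ← mul_two] at h
    -- What remains is `C(2k,k)^(1/p) ≤ 2`, that is `p_k ≤ p`.
    have h2 := le_of_mul_le_mul_left h (by positivity)
    rw [one_div, Real.rpow_inv_le_iff_of_pos (by positivity) two_pos.le hp0] at h2
    rwa [criticalExponent, Real.logb_le_iff_le_rpow one_lt_two
      (by exact_mod_cast Nat.choose_pos (by omega))]
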